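/- A set function on $[n]=\{1,\dots,n\}$ is a map $f:2^{[n]}\to\mathbb{R}$. It is $\epsilon$-modular if $|f(S)+f(T)-f(S\cup T)-f(S\cap T)|\le\epsilon$ for all $S,T\subseteq[n]$; it is linear if there are real constants $c_0,c_1,\dots,c_n$ with $f(S)=c_0+\sum_{i\in S}c_i$ for all $S$; and it is $\Delta$-linear if there is a linear set function $g$ with $|f(S)-g(S)|\le\Delta$ for all $S$. The strong Kalton constant $K_s$ is the smallest real $K\ge 0$ such that for every $n\ge 0$ and every $\epsilon\ge 0$, every $\epsilon$-modular set function on $[n]$ is $K\epsilon$-linear; that is, $K_s$ has this property, and for every $\kappa<K_s$ and every $\epsilon>0$ there are an $n$ and an $\epsilon$-modular set function on $[n]$ that is not $\kappa\epsilon$-linear. Theorem. For every $n\ge 0$ and every $\epsilon>0$, every $\epsilon$-modular set function on $[n]$ is $\Delta$-linear for some $\Delta<12.65\,\epsilon$. Moreover, the strong Kalton constant exists, is unique, and satisfies $K_s<12.65$. -/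

import Mathlib

/-- A real set function `f` over the ground set `[n]` is `ε`-modular. -/
def IsApproxModular {n : ℕ} (ε : ℝ) (f : Finset (Fin n) → ℝ) : Prop :=
  ∀ S T : Finset (Fin n), |f S + f T - f (S ∪ T) - f (S ∩ T)| ≤ ε

/-- A set function is linear if `g S = c₀ + ∑ i ∈ S, c i` for some real constants;
the constant term `c₀` is allowed to be nonzero. -/
def IsLinearSetFun {n : ℕ} (g : Finset (Fin n) → ℝ) : Prop :=
  ∃ (c₀ : ℝ) (c : Fin n → ℝ), ∀ S : Finset (Fin n), g S = c₀ + ∑ i ∈ S, c i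

/-- A set function is `Δ`-linear if some linear set function is pointwise `Δ`-close to it. -/
def IsApproxLinear {n : ℕ} (Δ : ℝ) (f : Finset (Fin n) → ℝ) : Prop :=
  ∃ g : Finset (Fin n) → ℝ, IsLinearSetFun g ∧ ∀ S : Finset (Fin n), |f S - g S| ≤ Δ

/-- `K` is the strong Kalton constant: for all `n` and `ε ≥ 0`, every `ε`-modular set function
over `[n]` is `K * ε`-linear, and no smaller `κ` has this property, for any fixed `ε > 0`.
(For `ε = 0` the second clause could not hold for any `K > 0`, as `0`-modular functions are
linear.) -/
def IsStrongKaltonConstant (K : ℝ) : Prop :=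
  0 ≤ K ∧
  (∀ (n : ℕ) (ε : ℝ), 0 ≤ ε → ∀ f : Finset (Fin n) → ℝ,
    IsApproxModular ε f → IsApproxLinear (K * ε) f) ∧
  (∀ κ : ℝ, κ < K → ∀ ε : ℝ, 0 < ε →
    ∃ (n : ℕ) (f : Finset (Fin n) → ℝ), IsApproxModular ε f ∧ ¬ IsApproxLinear (κ * ε) f)

/-!
Every `ε`-modular set function is `12.5 * ε`-linear, by a variant of the expander argument of Kalton
and Roberts.

The odd part `S ↦ (f S - f Sᶜ) / 2` is `ε`-modular, and `f` is within `ε / 2` of it up to an additive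
constant. So it suffices that the distance `M` of an odd `ε`-modular function `h` to the odd linear
functions is at most `12 * ε` (`norm_le_of_odd`). After subtraction of a closest odd linear function,
`M` is the norm of `h`, and no odd linear function separates the sets with `h S = M` from their
complements. A perceptron argument then produces long lists of such sets in which each item occurs
about half of the time (`exists_balanced_maximizers`).

Intersections of six sets from the list contain each item with frequency about `1 / 64`, and so do
complements of unions of six sets. For every sextuple, the values of `h` at these two sets still
differ by `2 * M - 7 * ε` (`IsApproxModular.inf_add_sup_of_six`). A random bipartite graph of left
degree 4 with eight times as many left as right vertices satisfies Hall's condition on all left sets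
of a fraction slightly above `1 / 64` (`exists_expander`). Along such a graph, `8 * m` sets can be
redistributed into `m` sets at a cost of `7 * ε` for each of the old ones
(`IsApproxModular.exists_redistribution`). As `|h| ≤ M` on the new sets, `8 * (2 * M - 7 * ε)` is at
most `2 * M + 2 * 8 * 7 * ε`, which is `M ≤ 12 * ε`.

The strong Kalton constant is the infimum of all valid constants. It is itself valid because the
distance of a set function to the linear ones is attained, and rescaling passes from one `ε` to all.
-/

/-! ### Disjoint unions -/

namespace IsApproxModular

variable {n : ℕ} {ε : ℝ} {f : Finset (Fin n) → ℝ}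

theorem nonneg (hf : IsApproxModular ε f) : 0 ≤ ε :=
  (abs_nonneg _).trans (hf ∅ ∅)

/-- Normalised by `f ∅`, an `ε`-modular function is additive on disjoint unions up to one `ε` for
each merging step. -/
theorem abs_biUnion_sub_sum_le {ι : Type*} [DecidableEq ι] (hf : IsApproxModular ε f)
    {s : Finset ι} (hs : s.Nonempty) (X : ι → Finset (Fin n))
    (hd : (s : Set ι).PairwiseDisjoint X) :
    |(f (s.biUnion X) - f ∅) - ∑ i ∈ s, (f (X i) - f ∅)| ≤ ((s.card : ℝ) - 1) * ε := by
  induction hs using Finset.Nonempty.cons_induction with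
  | singleton a => simp
  | cons a s ha hs ih =>
    have hdis : Disjoint (X a) (s.biUnion X) := by
      rw [Finset.disjoint_biUnion_right]
      intro i hi
      exact hd (by simp) (by simp [hi]) (by rintro rfl; exact ha hi)
    have h1 := ih (hd.subset (by simp))
    have h2 := hf (X a) (s.biUnion X)
    rw [Finset.disjoint_iff_inter_eq_empty.mp hdis] at h2
    rw [Finset.cons_eq_insert, Finset.biUnion_insert, Finset.sum_insert ha,
      Finset.card_insert_of_notMem ha]
    rw [abs_le] at h1 h2 ⊢
    push_cast
    constructor <;> linarith [h1.1, h1.2, h2.1, h2.2]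

theorem abs_biUnion_sub_sum_le_card {ι : Type*} [DecidableEq ι] (hf : IsApproxModular ε f)
    (s : Finset ι) (X : ι → Finset (Fin n)) (hd : (s : Set ι).PairwiseDisjoint X) :
    |(f (s.biUnion X) - f ∅) - ∑ i ∈ s, (f (X i) - f ∅)| ≤ (s.card : ℝ) * ε := by
  rcases s.eq_empty_or_nonempty with rfl | hs
  · simp
  · exact (hf.abs_biUnion_sub_sum_le hs X hd).trans
      (mul_le_mul_of_nonneg_right (by linarith) hf.nonneg)

/-! ### Redistributing sets along an expander -/

/-- Suppose that in the bipartite graph of left degree `d` given by `g`, the left vertices whose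
sets contain a given item always satisfy Hall's condition. Then the sets `X t` can be cut along the
edges at `t` and the pieces reassembled disjointly at the right vertices; up to `ε` for each cut and
each merge, `f` (normalised by `f ∅`) has the same sum over the old and the new sets. -/
theorem exists_redistribution {I V : Type*} [Fintype I] [Fintype V] [DecidableEq I]
    [DecidableEq V] {d : ℕ} [NeZero d] (hf : IsApproxModular ε f) (g : I → Fin d → V)
    (X : I → Finset (Fin n))
    (hall : ∀ (i : Fin n) (A : Finset I), (∀ t ∈ A, i ∈ X t) →
      A.card ≤ (A.biUnion fun t => Finset.univ.image (g t)).card) :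
    ∃ T : V → Finset (Fin n),
      |∑ t, (f (X t) - f ∅) - ∑ v, (f (T v) - f ∅)| ≤ (2 * d - 1) * Fintype.card I * ε := by
  -- For each item, Hall's theorem picks one edge at every set containing it.
  have key : ∀ i : Fin n, ∃ e : I → Fin d, ∀ t t', i ∈ X t → i ∈ X t' →
      g t (e t) = g t' (e t') → t = t' := by
    intro i
    obtain ⟨φ, hφ, hmem⟩ := (Finset.all_card_le_biUnion_card_iff_exists_injective
      (fun t : {t : I // i ∈ X t} => Finset.univ.image (g t.1))).mp (by
        intro s
        have := hall i (s.image Subtype.val) (by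
          intro t ht
          obtain ⟨u, -, rfl⟩ := Finset.mem_image.mp ht
          exact u.2)
        rwa [Finset.card_image_of_injective _ Subtype.val_injective, Finset.image_biUnion] at this)
    have hex : ∀ t : {t : I // i ∈ X t}, ∃ j, g t.1 j = φ t := fun t => by
      simpa using hmem t
    choose j hj using hex
    refine ⟨fun t => if h : i ∈ X t then j ⟨t, h⟩ else 0, fun t t' ht ht' h => ?_⟩
    simp only [ht, ht', dif_pos] at h
    rw [hj ⟨t, ht⟩, hj ⟨t', ht'⟩] at h
    exact congrArg Subtype.val (hφ h)
  choose e he using key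
  let Y : I × Fin d → Finset (Fin n) := fun p => (X p.1).filter fun i => e i p.1 = p.2
  let F : V → Finset (I × Fin d) := fun v => Finset.univ.filter fun p => g p.1 p.2 = v
  refine ⟨fun v => (F v).biUnion Y, ?_⟩
  have hsplit : ∀ t, |(f (X t) - f ∅) - ∑ j, (f (Y (t, j)) - f ∅)| ≤ ((d : ℝ) - 1) * ε := by
    intro t
    have h := hf.abs_biUnion_sub_sum_le (s := (Finset.univ : Finset (Fin d)))
      Finset.univ_nonempty (fun j => Y (t, j)) (by
        intro j _ j' _ hjj
        rw [Function.onFun, Finset.disjoint_left]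
        intro i hi hi'
        exact hjj ((Finset.mem_filter.mp hi).2.symm.trans (Finset.mem_filter.mp hi').2))
    have hU : (Finset.univ : Finset (Fin d)).biUnion (fun j => Y (t, j)) = X t := by
      ext i
      simp [Y]
    rw [hU] at h
    simpa using h
  have hmerge : ∀ v, |(f ((F v).biUnion Y) - f ∅) - ∑ p ∈ F v, (f (Y p) - f ∅)|
      ≤ ((F v).card : ℝ) * ε := by
    intro v
    refine hf.abs_biUnion_sub_sum_le_card (F v) Y ?_
    rintro ⟨t, j⟩ hp ⟨t', j'⟩ hp' hne
    rw [Function.onFun, Finset.disjoint_left]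
    intro i hi hi'
    simp only [F, Y, Finset.coe_filter, Finset.mem_univ, true_and, Set.mem_ofPred_eq,
      Finset.mem_filter] at hp hp' hi hi'
    have htt : t = t' := he i t t' hi.1 hi'.1 (by rw [hi.2, hi'.2, hp, hp'])
    subst htt
    exact hne (by rw [← hi.2, ← hi'.2])
  have hsum : ∑ v, ∑ p ∈ F v, (f (Y p) - f ∅) = ∑ t, ∑ j, (f (Y (t, j)) - f ∅) := by
    rw [← Fintype.sum_prod_type' (f := fun t j => f (Y (t, j)) - f ∅)]
    exact Finset.sum_fiberwise (s := Finset.univ) (g := fun p : I × Fin d => g p.1 p.2)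
      (f := fun p => f (Y p) - f ∅)
  have hcard : ∑ v, ((F v).card : ℝ) = Fintype.card I * d := by
    have h := Finset.card_eq_sum_card_fiberwise (s := (Finset.univ : Finset (I × Fin d)))
      (t := (Finset.univ : Finset V)) (f := fun p => g p.1 p.2) (by intro x _; simp)
    rw [Finset.card_univ, Fintype.card_prod, Fintype.card_fin] at h
    exact_mod_cast h.symm
  calc |∑ t, (f (X t) - f ∅) - ∑ v, (f ((F v).biUnion Y) - f ∅)|
      = |∑ t, ((f (X t) - f ∅) - ∑ j, (f (Y (t, j)) - f ∅))
          - ∑ v, ((f ((F v).biUnion Y) - f ∅) - ∑ p ∈ F v, (f (Y p) - f ∅))| := by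
        congr 1
        rw [Finset.sum_sub_distrib (s := (Finset.univ : Finset I))
            (f := fun t => f (X t) - f ∅),
          Finset.sum_sub_distrib (s := (Finset.univ : Finset V))
            (f := fun v => f ((F v).biUnion Y) - f ∅), hsum]
        ring
    _ ≤ ∑ t : I, ((d : ℝ) - 1) * ε + ∑ v, ((F v).card : ℝ) * ε :=
        (abs_sub _ _).trans (add_le_add
          ((Finset.abs_sum_le_sum_abs _ _).trans (Finset.sum_le_sum fun t _ => hsplit t))
          ((Finset.abs_sum_le_sum_abs _ _).trans (Finset.sum_le_sum fun v _ => hmerge v)))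
    _ = (2 * d - 1) * Fintype.card I * ε := by
        rw [← Finset.sum_mul (s := (Finset.univ : Finset V)), hcard, Finset.sum_const,
          Finset.card_univ, nsmul_eq_mul]
        ring

/-! ### Intersections and unions of six sets of large value -/

/-- Each of the three pairs `(S 0, S 1)`, `(S 2, S 3)`, `(S 4, S 5)` has intersection and union of
total value at least `2 * M - ε`; merging the three intersections, and the three unions, costs
`M + ε` for each of four steps. -/
theorem inf_add_sup_of_six (hf : IsApproxModular ε f) {M : ℝ} (hM : ∀ S, f S ≤ M)
    (S : Fin 6 → Finset (Fin n)) (hS : ∀ j, f (S j) = M) :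
    2 * M - 7 * ε ≤ f (Finset.univ.inf S) + f (Finset.univ.sup S) := by
  have hinf : Finset.univ.inf S = ((S 0 ∩ S 1) ∩ (S 2 ∩ S 3)) ∩ (S 4 ∩ S 5) := by
    ext i; simp [Finset.mem_inf, Fin.forall_fin_succ]
  have hsup : Finset.univ.sup S = ((S 0 ∪ S 1) ∪ (S 2 ∪ S 3)) ∪ (S 4 ∪ S 5) := by
    ext i; simp [Finset.mem_sup, Fin.exists_fin_succ]
  rw [hinf, hsup]
  have h := fun A B => abs_le.mp (hf A B)
  have h01 := h (S 0) (S 1)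
  have h23 := h (S 2) (S 3)
  have h45 := h (S 4) (S 5)
  have hi := h (S 0 ∩ S 1) (S 2 ∩ S 3)
  have hi' := h ((S 0 ∩ S 1) ∩ (S 2 ∩ S 3)) (S 4 ∩ S 5)
  have hu := h (S 0 ∪ S 1) (S 2 ∪ S 3)
  have hu' := h ((S 0 ∪ S 1) ∪ (S 2 ∪ S 3)) (S 4 ∪ S 5)
  rw [hS, hS] at h01 h23 h45
  linarith [h01.2, h23.2, h45.2, hi.2, hi'.2, hu.2, hu'.2,
    hM ((S 0 ∩ S 1) ∪ (S 2 ∩ S 3)), hM (((S 0 ∩ S 1) ∩ (S 2 ∩ S 3)) ∪ (S 4 ∩ S 5)),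
    hM ((S 0 ∪ S 1) ∩ (S 2 ∪ S 3)), hM (((S 0 ∪ S 1) ∪ (S 2 ∪ S 3)) ∩ (S 4 ∪ S 5))]

end IsApproxModular

/-! ### Existence of expanders -/

/-- The number of `d`-regular left neighbour assignments sending `A` into `B`. -/
theorem card_maps_into {I : Type*} [Fintype I] [DecidableEq I] {m s : ℕ} (d : ℕ)
    (A : Finset I) (B : Finset (Fin m)) (hA : A.card = s) (hB : B.card = s) :
    (Finset.univ.filter fun g : I → Fin d → Fin m => ∀ t ∈ A, ∀ j, g t j ∈ B).card
      = s ^ (d * s) * m ^ (d * (Fintype.card I - s)) := by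
  have h : (Finset.univ.filter fun g : I → Fin d → Fin m => ∀ t ∈ A, ∀ j, g t j ∈ B)
      = Fintype.piFinset fun t => if t ∈ A then Fintype.piFinset (fun _ : Fin d => B)
          else Finset.univ := by
    ext g
    simp only [Finset.mem_filter, Finset.mem_univ, true_and, Fintype.mem_piFinset]
    refine forall_congr' fun t => ?_
    by_cases ht : t ∈ A <;> simp [ht]
  rw [h, Fintype.card_piFinset]
  have h2 : ∀ t : I, (if t ∈ A then Fintype.piFinset (fun _ : Fin d => B)
      else (Finset.univ : Finset (Fin d → Fin m))).card = if t ∈ A then s ^ d else m ^ d := by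
    intro t
    by_cases ht : t ∈ A <;> simp [ht, hB]
  rw [Finset.prod_congr rfl fun t _ => h2 t, Finset.prod_ite, Finset.prod_const,
    Finset.prod_const, Finset.filter_mem_eq_inter, Finset.univ_inter, hA,
    Finset.filter_notMem_eq_sdiff, ← Finset.compl_eq_univ_sdiff, Finset.card_compl, hA,
    ← pow_mul, ← pow_mul]

/-- The union bound for the expander at size `s`. By `s ^ s / s ! ≤ e ^ s` the left side is at most
`(8 * e ^ 2 * (s / m) ^ 2) ^ s * m ^ (32 * m)`, whose base is at most `0.955` for `s ≤ 0.127 * m`;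
the surplus factor `(s / (0.127 * m)) ^ (2 * s)` makes the sum over `s` tend to zero with `m`. -/
theorem expander_term_le {m s : ℕ} (hm : 0 < m) (hs : 1 ≤ s) (hsm : (s : ℝ) ≤ 0.127 * m) :
    ((8 * m).choose s * m.choose s * (s ^ (4 * s) * m ^ (4 * (8 * m - s))) : ℝ)
      ≤ 8 / m * (s * 0.955 ^ s) * (m : ℝ) ^ (32 * m) := by
  have hm' : (0 : ℝ) < m := by exact_mod_cast hm
  have hs' : (1 : ℝ) ≤ s := by exact_mod_cast hs
  have hsm8 : s ≤ 8 * m := by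
    have : (s : ℝ) ≤ (8 * m : ℕ) := by push_cast; linarith
    exact_mod_cast this
  have h1 : ((8 * m).choose s : ℝ) ≤ (8 * m) ^ s / s.factorial := by
    have := Nat.choose_le_pow_div (α := ℝ) s (8 * m)
    push_cast at this
    exact this
  have h2 : (m.choose s : ℝ) ≤ (m : ℝ) ^ s / s.factorial := Nat.choose_le_pow_div s m
  have h3 : (s : ℝ) ^ s / s.factorial ≤ Real.exp 1 ^ s := by
    rw [← Real.exp_nat_mul, mul_one]
    exact Real.pow_div_factorial_le_exp (s : ℝ) (by linarith) s
  have hpow : (m : ℝ) ^ (32 * m) = m ^ (4 * (8 * m - s)) * m ^ (4 * s) := by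
    rw [← pow_add]; congr 1; omega
  have hfac : (0 : ℝ) < s.factorial := by exact_mod_cast s.factorial_pos
  set x : ℝ := s / (0.127 * m) with hx
  have hx0 : 0 ≤ x := by positivity
  have hx1 : x ≤ 1 := (div_le_one (by positivity)).mpr hsm
  have he : Real.exp 1 ^ 2 * 8 * 0.127 ^ 2 ≤ 0.955 := by
    have := Real.exp_one_lt_d9
    have h0 := Real.exp_pos 1
    nlinarith
  have hmain : (8 * m : ℝ) ^ s / s.factorial * ((m : ℝ) ^ s / s.factorial) * (s : ℝ) ^ (4 * s)
      ≤ 8 / m * (s * 0.955 ^ s) * (m : ℝ) ^ (4 * s) := by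
    calc (8 * m : ℝ) ^ s / s.factorial * ((m : ℝ) ^ s / s.factorial) * (s : ℝ) ^ (4 * s)
        = ((s : ℝ) ^ s / s.factorial) ^ 2 * (8 * (s / m) ^ 2) ^ s * (m : ℝ) ^ (4 * s) := by
          rw [mul_pow, mul_pow, ← pow_mul, div_pow, div_pow, ← pow_mul, pow_mul (s : ℝ) 4 s,
            pow_mul (m : ℝ) 4 s]
          field_simp
          ring
      _ ≤ (Real.exp 1 ^ s) ^ 2 * (8 * (s / m) ^ 2) ^ s * (m : ℝ) ^ (4 * s) := by gcongr
      _ = (Real.exp 1 ^ 2 * 8 * 0.127 ^ 2) ^ s * (x ^ (2 * s)) * (m : ℝ) ^ (4 * s) := by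
          rw [← pow_mul, mul_comm s 2, pow_mul, ← mul_pow, pow_mul x, ← mul_pow]
          congr 2
          rw [hx]
          field_simp
      _ ≤ 0.955 ^ s * x * (m : ℝ) ^ (4 * s) := by
          gcongr
          exact pow_le_of_le_one hx0 hx1 (by omega)
      _ ≤ 8 / m * (s * 0.955 ^ s) * (m : ℝ) ^ (4 * s) := by
          have hxs : x ≤ 8 / m * s := by
            rw [hx, div_mul_eq_mul_div, div_le_div_iff₀ (by positivity) hm']
            nlinarith [mul_nonneg (zero_le_one.trans hs') hm'.le]
          calc (0.955 : ℝ) ^ s * x * (m : ℝ) ^ (4 * s)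
              ≤ 0.955 ^ s * (8 / m * s) * (m : ℝ) ^ (4 * s) := by gcongr
            _ = 8 / m * (s * 0.955 ^ s) * (m : ℝ) ^ (4 * s) := by ring
  rw [hpow]
  calc ((8 * m).choose s * m.choose s * (s ^ (4 * s) * m ^ (4 * (8 * m - s))) : ℝ)
      = ((8 * m).choose s * m.choose s * s ^ (4 * s)) * m ^ (4 * (8 * m - s)) := by ring
    _ ≤ ((8 * m : ℝ) ^ s / s.factorial * ((m : ℝ) ^ s / s.factorial) * (s : ℝ) ^ (4 * s))
          * m ^ (4 * (8 * m - s)) := by gcongr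
    _ ≤ (8 / m * (s * 0.955 ^ s) * (m : ℝ) ^ (4 * s)) * m ^ (4 * (8 * m - s)) := by gcongr
    _ = _ := by ring

/-- A random bipartite graph with `8 * m` left vertices of degree 4 and `m` right vertices satisfies
Hall's condition on all left sets of size at most `0.127 * m`, a little more than a fraction
`1 / 64` of the left side. -/
theorem exists_expander {m : ℕ} (hm : 10000 ≤ m) {I : Type*} [Fintype I] [DecidableEq I]
    (hI : Fintype.card I = 8 * m) :
    ∃ g : I → Fin 4 → Fin m, ∀ A : Finset I, (A.card : ℝ) ≤ 0.127 * m →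
      A.card ≤ (A.biUnion fun t => Finset.univ.image (g t)).card := by
  have hm0 : 0 < m := by omega
  have hmR : (10000 : ℝ) ≤ m := by exact_mod_cast hm
  by_contra! hcon
  let sizes := (Finset.Icc 1 m).filter fun s : ℕ => (s : ℝ) ≤ 0.127 * m
  let bad : Finset I → Finset (Fin m) → Finset (I → Fin 4 → Fin m) := fun A B =>
    Finset.univ.filter fun g => ∀ t ∈ A, ∀ j, g t j ∈ B
  -- Enlarging the neighbourhood of a violating set `A` gives a set `B` of the same size as `A`.
  have hcover : (Finset.univ : Finset (I → Fin 4 → Fin m)) ⊆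
      sizes.biUnion fun s => (Finset.powersetCard s Finset.univ).biUnion fun A =>
        (Finset.powersetCard s Finset.univ).biUnion fun B => bad A B := by
    intro g _
    obtain ⟨A, hA, hlt⟩ := hcon g
    have hAm : A.card ≤ m := by
      have : (A.card : ℝ) ≤ m := by linarith
      exact_mod_cast this
    obtain ⟨B, hNB, -, hB⟩ := Finset.exists_subsuperset_card_eq
      (Finset.subset_univ (A.biUnion fun t => Finset.univ.image (g t))) hlt.le (by simpa using hAm)
    simp only [Finset.mem_biUnion, Finset.mem_powersetCard, Finset.subset_univ, true_and]
    refine ⟨A.card, ?_, A, rfl, B, hB, ?_⟩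
    · simp only [sizes, Finset.mem_filter, Finset.mem_Icc]
      exact ⟨⟨by omega, hAm⟩, hA⟩
    · simp only [bad, Finset.mem_filter, Finset.mem_univ, true_and]
      intro t ht j
      exact hNB (Finset.mem_biUnion.mpr ⟨t, ht, Finset.mem_image_of_mem _ (Finset.mem_univ j)⟩)
  have hcount : m ^ (32 * m) ≤ ∑ s ∈ sizes,
      (8 * m).choose s * m.choose s * (s ^ (4 * s) * m ^ (4 * (8 * m - s))) := by
    have htot : (Finset.univ : Finset (I → Fin 4 → Fin m)).card = m ^ (32 * m) := by
      rw [Finset.card_univ]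
      simp only [Fintype.card_fun, Fintype.card_fin, hI]
      rw [← pow_mul]; congr 1; omega
    rw [← htot]
    refine (Finset.card_le_card hcover).trans (Finset.card_biUnion_le.trans ?_)
    refine Finset.sum_le_sum fun s _ => ?_
    rw [mul_assoc]
    refine (Finset.card_biUnion_le_card_mul _ _ _ fun A hA => ?_).trans_eq
      (by rw [Finset.card_powersetCard, Finset.card_univ, hI])
    refine (Finset.card_biUnion_le_card_mul _ _ _ fun B hB => ?_).trans_eq
      (by rw [Finset.card_powersetCard, Finset.card_univ, Fintype.card_fin])
    rw [card_maps_into 4 A B (Finset.mem_powersetCard.mp hA).2 (Finset.mem_powersetCard.mp hB).2,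
      hI]
  have hgeom : ∑ s ∈ sizes, ((s : ℝ) * 0.955 ^ s) ≤ 0.955 / (1 - 0.955) ^ 2 :=
    sum_le_hasSum _ (fun s _ => by positivity)
      (hasSum_coe_mul_geometric_of_norm_lt_one (by norm_num))
  have hle : (m : ℝ) ^ (32 * m) ≤ 8 / m * (0.955 / (1 - 0.955) ^ 2) * (m : ℝ) ^ (32 * m) := by
    calc (m : ℝ) ^ (32 * m) ≤ ∑ s ∈ sizes,
          ((8 * m).choose s * m.choose s * (s ^ (4 * s) * m ^ (4 * (8 * m - s))) : ℝ) := by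
          exact_mod_cast hcount
      _ ≤ ∑ s ∈ sizes, 8 / m * (s * 0.955 ^ s) * (m : ℝ) ^ (32 * m) := by
          refine Finset.sum_le_sum fun s hs => ?_
          simp only [sizes, Finset.mem_filter, Finset.mem_Icc] at hs
          exact expander_term_le hm0 hs.1.1 hs.2
      _ = 8 / m * (∑ s ∈ sizes, (s : ℝ) * 0.955 ^ s) * (m : ℝ) ^ (32 * m) := by
          rw [Finset.mul_sum, Finset.sum_mul]
      _ ≤ _ := by gcongr
  have hpos : (0 : ℝ) < (m : ℝ) ^ (32 * m) := by positivity
  have hlt : 8 / (m : ℝ) * (0.955 / (1 - 0.955) ^ 2) < 1 := by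
    rw [div_mul_eq_mul_div, div_lt_one (by linarith)]
    norm_num
    linarith
  nlinarith

/-! ### Odd set functions -/

/-- The vector of signs of a set `S`: the coordinate at `i` is `1` if `i ∈ S` and `-1` otherwise. -/
def signVec {n : ℕ} (S : Finset (Fin n)) (i : Fin n) : ℝ := if i ∈ S then 1 else -1

theorem signVec_compl {n : ℕ} (S : Finset (Fin n)) (i : Fin n) :
    signVec Sᶜ i = -signVec S i := by
  by_cases h : i ∈ S <;> simp [signVec, h]

theorem signVec_sq {n : ℕ} (S : Finset (Fin n)) (i : Fin n) : signVec S i ^ 2 = 1 := by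
  by_cases h : i ∈ S <;> simp [signVec, h]

/-- The linear map sending coefficients `c` to the set function `S ↦ ∑ i, c i * signVec S i`. Its
range consists of the linear set functions that change sign under complementation. -/
def oddLinear (n : ℕ) : (Fin n → ℝ) →ₗ[ℝ] (Finset (Fin n) → ℝ) where
  toFun c S := ∑ i, c i * signVec S i
  map_add' c d := by ext S; simp [add_mul, Finset.sum_add_distrib]
  map_smul' a c := by ext S; simp [Finset.mul_sum, mul_assoc]

theorem oddLinear_apply {n : ℕ} (c : Fin n → ℝ) (S : Finset (Fin n)) :
    oddLinear n c S = ∑ i, c i * signVec S i := rfl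

theorem oddLinear_compl {n : ℕ} (c : Fin n → ℝ) (S : Finset (Fin n)) :
    oddLinear n c Sᶜ = -oddLinear n c S := by
  simp [oddLinear_apply, signVec_compl]

theorem oddLinear_eq {n : ℕ} (c : Fin n → ℝ) (S : Finset (Fin n)) :
    oddLinear n c S = -∑ i, c i + ∑ i ∈ S, 2 * c i := by
  have h : ∀ i, c i * signVec S i = -c i + if i ∈ S then 2 * c i else 0 := by
    intro i
    by_cases h : i ∈ S <;> simp [signVec, h]; ring
  simp only [oddLinear_apply, h, Finset.sum_add_distrib, Finset.sum_neg_distrib,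
    Finset.sum_ite_mem, Finset.univ_inter]

/-- A nonzero odd set function that is not approximated better by any odd linear function than by
`0` has, for each sign pattern `s`, a maximiser whose sign vector does not correlate positively
with `s`: otherwise subtracting a small multiple of `oddLinear n s` would reduce the norm. -/
theorem exists_eq_norm_oddLinear_nonpos {n : ℕ} {h : Finset (Fin n) → ℝ}
    (hodd : ∀ S, h Sᶜ = -h S) (hpos : 0 < ‖h‖) (hmin : ∀ c, ‖h‖ ≤ ‖h - oddLinear n c‖)
    (s : Fin n → ℝ) : ∃ S, h S = ‖h‖ ∧ oddLinear n s S ≤ 0 := by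
  by_contra! hcon
  have hcon' : ∀ S, h S = -‖h‖ → oddLinear n s S < 0 := by
    intro S hS
    have := hcon Sᶜ (by rw [hodd, hS, neg_neg])
    rw [oddLinear_compl] at this
    linarith
  have hev : ∀ᶠ t : ℝ in nhdsWithin 0 (Set.Ioi 0), ∀ S, |h S - t * oddLinear n s S| < ‖h‖ := by
    rw [Filter.eventually_all]
    intro S
    have hb : |h S| ≤ ‖h‖ := norm_le_pi_norm h S
    have hup : ∀ᶠ t : ℝ in nhdsWithin 0 (Set.Ioi 0), h S - t * oddLinear n s S < ‖h‖ := by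
      rcases (abs_le.mp hb).2.lt_or_eq with hlt | heq
      · have hc : Filter.Tendsto (fun t : ℝ => h S - t * oddLinear n s S) (nhds 0)
            (nhds (h S - 0 * oddLinear n s S)) := by
          apply Continuous.tendsto; fun_prop
        exact (hc.mono_left nhdsWithin_le_nhds).eventually_lt_const (by simpa using hlt)
      · filter_upwards [self_mem_nhdsWithin] with t ht
        have := mul_pos (show (0 : ℝ) < t from ht) (hcon S heq)
        linarith
    have hlow : ∀ᶠ t : ℝ in nhdsWithin 0 (Set.Ioi 0), -‖h‖ < h S - t * oddLinear n s S := by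
      rcases (abs_le.mp hb).1.lt_or_eq with hlt | heq
      · have hc : Filter.Tendsto (fun t : ℝ => h S - t * oddLinear n s S) (nhds 0)
            (nhds (h S - 0 * oddLinear n s S)) := by
          apply Continuous.tendsto; fun_prop
        exact (hc.mono_left nhdsWithin_le_nhds).eventually_const_lt (by simpa using hlt)
      · filter_upwards [self_mem_nhdsWithin] with t ht
        have := mul_pos_of_neg_of_neg (neg_neg_of_pos (show (0 : ℝ) < t from ht)) (hcon' S heq.symm)
        linarith
    filter_upwards [hup, hlow] with t h1 h2
    exact abs_lt.mpr ⟨h2, h1⟩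
  obtain ⟨t, ht⟩ := hev.exists
  refine (hmin (t • s)).not_gt ((pi_norm_lt_iff hpos).mpr fun S => ?_)
  simpa [Real.norm_eq_abs] using ht S

/-- The perceptron argument: choosing each new maximiser so as not to correlate with the sum of
the sign vectors chosen before keeps the square of the norm of that sum linear in `N`. -/
theorem exists_balanced_maximizers {n : ℕ} {h : Finset (Fin n) → ℝ}
    (hodd : ∀ S, h Sᶜ = -h S) (hpos : 0 < ‖h‖) (hmin : ∀ c, ‖h‖ ≤ ‖h - oddLinear n c‖) (N : ℕ) :
    ∃ S : Fin N → Finset (Fin n), (∀ t, h (S t) = ‖h‖) ∧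
      ∑ i, (∑ t, signVec (S t) i) ^ 2 ≤ N * n := by
  induction N with
  | zero => exact ⟨Fin.elim0, fun t => t.elim0, by simp⟩
  | succ N ih =>
    obtain ⟨S, hS, hsum⟩ := ih
    obtain ⟨A, hA, hle⟩ := exists_eq_norm_oddLinear_nonpos hodd hpos hmin
      (fun i => ∑ t, signVec (S t) i)
    refine ⟨Fin.snoc S A, fun t => ?_, ?_⟩
    · refine Fin.lastCases ?_ (fun t => ?_) t <;> simp [hA, hS]
    · simp only [Fin.sum_univ_castSucc, Fin.snoc_castSucc, Fin.snoc_last, add_sq, signVec_sq,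
        Finset.sum_add_distrib, mul_assoc, ← Finset.mul_sum]
      rw [oddLinear_apply] at hle
      simp only [Finset.sum_const, Finset.card_univ, Fintype.card_fin, nsmul_eq_mul]
      push_cast
      linarith

theorem sum_signVec {n N : ℕ} (S : Fin N → Finset (Fin n)) (i : Fin n) :
    ∑ t, signVec (S t) i = 2 * (Finset.univ.filter fun t => i ∈ S t).card - N := by
  have h : ∀ t, signVec (S t) i = 2 * (if i ∈ S t then 1 else 0) - 1 := by
    intro t
    by_cases h : i ∈ S t <;> simp [signVec, h]; norm_num
  simp only [h, Finset.sum_sub_distrib, ← Finset.mul_sum, Finset.sum_boole]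
  simp

/-- Each item lies in at most a fraction `0.501` of the sets of a balanced family, and is missing
from at most such a fraction. -/
theorem card_mem_le {n N : ℕ} (hN : 250000 * n ≤ N) {S : Fin N → Finset (Fin n)}
    (hS : ∑ i, (∑ t, signVec (S t) i) ^ 2 ≤ (N * n : ℝ)) (i : Fin n) :
    ((Finset.univ.filter fun t => i ∈ S t).card : ℝ) ≤ 0.501 * N ∧
      ((Finset.univ.filter fun t => i ∈ (S t)ᶜ).card : ℝ) ≤ 0.501 * N := by
  have hN' : (250000 * n : ℝ) ≤ N := by exact_mod_cast hN
  have h1 : (∑ t, signVec (S t) i) ^ 2 ≤ (0.002 * N) ^ 2 := by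
    have h := Finset.single_le_sum (f := fun i => (∑ t, signVec (S t) i) ^ 2)
      (fun i _ => sq_nonneg _) (Finset.mem_univ i)
    have : (N * n : ℝ) ≤ (0.002 * N) ^ 2 := by nlinarith [(Nat.cast_nonneg N : (0 : ℝ) ≤ N)]
    exact h.trans (hS.trans this)
  have h2 := abs_le_of_sq_le_sq' h1 (by positivity)
  have h3 := sum_signVec S i
  have h4 := sum_signVec (fun t => (S t)ᶜ) i
  simp only [signVec_compl, Finset.sum_neg_distrib] at h4
  constructor <;> linarith [h2.1, h2.2]

/-- An item common to at most a fraction `0.501` of `2 * q` sets lies in at most a fraction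
`0.501 ^ 6` of the intersections of six of them, slightly above `1 / 64`. -/
theorem card_le_of_forall_mem_inf {n q : ℕ} {S : Fin (2 * q) → Finset (Fin n)} {i : Fin n}
    (hi : ((Finset.univ.filter fun t => i ∈ S t).card : ℝ) ≤ 0.501 * (2 * q : ℕ))
    (A : Finset (Fin 6 → Fin (2 * q))) (hA : ∀ t ∈ A, i ∈ Finset.univ.inf fun j => S (t j)) :
    (A.card : ℝ) ≤ 0.127 * (8 * q ^ 6 : ℕ) := by
  have hsub : A ⊆ Fintype.piFinset fun _ : Fin 6 => Finset.univ.filter fun t => i ∈ S t := by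
    intro t ht
    simpa [Fintype.mem_piFinset, Finset.mem_inf] using hA t ht
  have h := Finset.card_le_card hsub
  rw [Fintype.card_piFinset_const] at h
  calc (A.card : ℝ) ≤ ((Finset.univ.filter fun t => i ∈ S t).card : ℝ) ^ 6 := by
        exact_mod_cast h
    _ ≤ (0.501 * (2 * q : ℕ)) ^ 6 := by gcongr
    _ ≤ 0.127 * (8 * q ^ 6 : ℕ) := by
        push_cast
        rw [mul_pow, mul_pow]
        nlinarith [pow_nonneg (Nat.cast_nonneg q : (0 : ℝ) ≤ q) 6]

/-- The distance bound for odd functions. With `M = ‖h‖`, the sextuples of balanced maximisers give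
`8 * m` pairs (intersection, complement of union) whose values differ by `2 * M - 7 * ε` on
average. Redistributing both families over `m` sets changes each sum by at most `56 * m * ε`, and
the `m` new pairs differ by at most `2 * M`; so `8 * (2 * M - 7 * ε) ≤ 2 * M + 112 * ε`. -/
theorem norm_le_of_odd {n : ℕ} {ε : ℝ} {h : Finset (Fin n) → ℝ} (hf : IsApproxModular ε h)
    (hodd : ∀ S, h Sᶜ = -h S) (hmin : ∀ c, ‖h‖ ≤ ‖h - oddLinear n c‖) : ‖h‖ ≤ 12 * ε := by
  rcases (norm_nonneg h).eq_or_lt with h0 | hpos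
  · rw [← h0]; linarith [hf.nonneg]
  set M := ‖h‖ with hM
  have hle : ∀ S, |h S| ≤ M := norm_le_pi_norm h
  let q := 125000 * n + 10000
  let m := 8 * q ^ 6
  obtain ⟨S, hS, hsum⟩ := exists_balanced_maximizers hodd hpos hmin (2 * q)
  have hcard := card_mem_le (by simp only [q]; omega) hsum
  have hq : 10000 ≤ m := by
    have h1 : q ≤ q ^ 6 := Nat.le_self_pow (by norm_num) q
    simp only [m]
    omega
  have hI : Fintype.card (Fin 6 → Fin (2 * q)) = 8 * m := by
    simp only [Fintype.card_fun, Fintype.card_fin, m]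
    ring
  obtain ⟨g, hg⟩ := exists_expander hq hI
  obtain ⟨T, hT⟩ := hf.exists_redistribution g (fun t => Finset.univ.inf fun j => S (t j))
    fun i A hA => hg A (card_le_of_forall_mem_inf (hcard i).1 A hA)
  obtain ⟨T', hT'⟩ := hf.exists_redistribution g (fun t => Finset.univ.inf fun j => (S (t j))ᶜ)
    fun i A hA => hg A (card_le_of_forall_mem_inf (S := fun t => (S t)ᶜ) (hcard i).2 A hA)
  have hpair : ∀ t : Fin 6 → Fin (2 * q), 2 * M - 7 * ε ≤
      h (Finset.univ.inf fun j => S (t j)) - h (Finset.univ.inf fun j => (S (t j))ᶜ) := by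
    intro t
    have h1 := hf.inf_add_sup_of_six (fun S => (abs_le.mp (hle S)).2) (fun j => S (t j))
      fun j => hS (t j)
    have h2 : (Finset.univ.inf fun j => (S (t j))ᶜ) = (Finset.univ.sup fun j => S (t j))ᶜ := by
      rw [Finset.compl_sup]
    rw [h2, hodd]
    linarith
  have hlow : (8 * m : ℝ) * (2 * M - 7 * ε) ≤
      ∑ t : Fin 6 → Fin (2 * q), (h (Finset.univ.inf fun j => S (t j)) - h ∅)
        - ∑ t : Fin 6 → Fin (2 * q), (h (Finset.univ.inf fun j => (S (t j))ᶜ) - h ∅) := by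
    rw [← Finset.sum_sub_distrib]
    have := Finset.card_nsmul_le_sum (Finset.univ : Finset (Fin 6 → Fin (2 * q))) _ _
      fun t _ => (hpair t).trans_eq
        (sub_sub_sub_cancel_right _ _ (h ∅)).symm
    rw [Finset.card_univ, hI, nsmul_eq_mul] at this
    exact_mod_cast this
  have hup : ∑ v, (h (T v) - h ∅) - ∑ v, (h (T' v) - h ∅) ≤ m * (2 * M) := by
    rw [← Finset.sum_sub_distrib]
    have := Finset.sum_le_card_nsmul (Finset.univ : Finset (Fin m))
      (fun v => (h (T v) - h ∅) - (h (T' v) - h ∅)) (2 * M) fun v _ => by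
        linarith [(abs_le.mp (hle (T v))).2, (abs_le.mp (hle (T' v))).1]
    simpa [nsmul_eq_mul] using this
  rw [hI] at hT hT'
  have hmR : (0 : ℝ) < m := by
    have : 0 < m := by omega
    exact_mod_cast this
  have hfin : (m : ℝ) * (14 * M) ≤ m * (168 * ε) := by
    have a := (abs_le.mp hT).2
    have b := (abs_le.mp hT').1
    push_cast at a b
    linarith
  have := le_of_mul_le_mul_left hfin hmR
  linarith

/-! ### Approximation of modular functions by linear ones -/

theorem isLinearSetFun_const_add_oddLinear {n : ℕ} (a : ℝ) (c : Fin n → ℝ) :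
    IsLinearSetFun fun S => a + oddLinear n c S :=
  ⟨a - ∑ i, c i, fun i => 2 * c i, fun S => by simp only [oddLinear_eq]; ring⟩

theorem IsApproxModular.sub_oddLinear {n : ℕ} {ε : ℝ} {f : Finset (Fin n) → ℝ}
    (hf : IsApproxModular ε f) (c : Fin n → ℝ) : IsApproxModular ε (f - oddLinear n c) := by
  intro S T
  have h : ∑ i ∈ S ∪ T, 2 * c i + ∑ i ∈ S ∩ T, 2 * c i = ∑ i ∈ S, 2 * c i + ∑ i ∈ T, 2 * c i :=
    Finset.sum_union_inter
  convert hf S T using 2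
  simp only [Pi.sub_apply, oddLinear_eq]
  linarith

theorem IsApproxModular.oddPart {n : ℕ} {ε : ℝ} {f : Finset (Fin n) → ℝ}
    (hf : IsApproxModular ε f) : IsApproxModular ε fun S => (f S - f Sᶜ) / 2 := by
  intro S T
  have h1 := abs_le.mp (hf S T)
  have h2 := abs_le.mp (hf Sᶜ Tᶜ)
  rw [← Finset.compl_union, ← Finset.compl_inter] at h2
  exact abs_le.mpr ⟨by linarith [h1.1, h2.2], by linarith [h1.2, h2.1]⟩

/-- The odd part of `f` is within `12 * ε` of an odd linear function, and `f` differs from its odd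
part by `(f S + f Sᶜ) / 2`, which is within `ε / 2` of the constant `(f univ + f ∅) / 2`. -/
theorem IsApproxModular.isApproxLinear {n : ℕ} {ε : ℝ} {f : Finset (Fin n) → ℝ}
    (hf : IsApproxModular ε f) : IsApproxLinear (12.5 * ε) f := by
  let h₀ : Finset (Fin n) → ℝ := fun S => (f S - f Sᶜ) / 2
  obtain ⟨_, ⟨c, rfl⟩, hc⟩ := (Submodule.closed_of_finiteDimensional
    (LinearMap.range (oddLinear n))).exists_infDist_eq_dist (Submodule.nonempty _) h₀
  have hmin : ∀ d, ‖h₀ - oddLinear n c‖ ≤ ‖h₀ - oddLinear n c - oddLinear n d‖ := by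
    intro d
    rw [sub_sub, ← map_add, ← dist_eq_norm, ← dist_eq_norm, ← hc]
    exact Metric.infDist_le_dist_of_mem ⟨c + d, rfl⟩
  have hb := norm_le_of_odd (hf.oddPart.sub_oddLinear c) (fun S => by
    simp only [Pi.sub_apply, oddLinear_compl, compl_compl]; ring) hmin
  refine ⟨_, isLinearSetFun_const_add_oddLinear ((f Finset.univ + f ∅) / 2) c, fun S => ?_⟩
  have h1 := abs_le.mp ((norm_le_pi_norm (h₀ - oddLinear n c) S).trans hb)
  have h2 := abs_le.mp (hf S Sᶜ)
  rw [Finset.union_compl, Finset.inter_compl] at h2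
  simp only [Pi.sub_apply, h₀] at h1
  exact abs_le.mpr ⟨by linarith [h1.1, h2.1], by linarith [h1.2, h2.2]⟩

/-! ### The strong Kalton constant -/

/-- The linear set functions, as a subspace. -/
def linearSetFun (n : ℕ) : Submodule ℝ (Finset (Fin n) → ℝ) where
  carrier := {g | IsLinearSetFun g}
  zero_mem' := ⟨0, 0, fun S => by simp⟩
  add_mem' := by
    rintro _ _ ⟨a, c, hc⟩ ⟨b, d, hd⟩
    exact ⟨a + b, c + d, fun S => by simp [hc, hd, Finset.sum_add_distrib]; ring⟩
  smul_mem' := by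
    rintro r _ ⟨a, c, hc⟩
    exact ⟨r * a, r • c, fun S => by simp [hc, Finset.mul_sum, mul_add]⟩

theorem isApproxLinear_iff_infDist_le {n : ℕ} {Δ : ℝ} {f : Finset (Fin n) → ℝ} :
    IsApproxLinear Δ f ↔ Metric.infDist f (linearSetFun n) ≤ Δ := by
  constructor
  · rintro ⟨g, hg, hfg⟩
    have hΔ : 0 ≤ Δ := (abs_nonneg _).trans (hfg ∅)
    refine (Metric.infDist_le_dist_of_mem (show g ∈ (linearSetFun n : Set _) from hg)).trans ?_
    exact (dist_pi_le_iff hΔ).mpr hfg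
  · intro h
    obtain ⟨g, hg, hd⟩ := (Submodule.closed_of_finiteDimensional
      (linearSetFun n)).exists_infDist_eq_dist (Submodule.nonempty _) f
    exact ⟨g, hg, fun S => (dist_le_pi_dist f g S).trans (hd ▸ h)⟩

theorem IsApproxLinear.const_mul {n : ℕ} {Δ r : ℝ} {f : Finset (Fin n) → ℝ} (hr : 0 ≤ r)
    (hf : IsApproxLinear Δ f) : IsApproxLinear (r * Δ) fun S => r * f S := by
  obtain ⟨g, ⟨a, c, hc⟩, hfg⟩ := hf
  refine ⟨fun S => r * g S, ⟨r * a, fun i => r * c i, fun S => ?_⟩, fun S => ?_⟩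
  · simp only [hc, mul_add, Finset.mul_sum]
  · rw [← mul_sub, abs_mul, abs_of_nonneg hr]
    exact mul_le_mul_of_nonneg_left (hfg S) hr

theorem IsApproxModular.const_mul {n : ℕ} {ε r : ℝ} {f : Finset (Fin n) → ℝ} (hr : 0 ≤ r)
    (hf : IsApproxModular ε f) : IsApproxModular (r * ε) fun S => r * f S := by
  intro S T
  rw [← mul_add, ← mul_sub, ← mul_sub, abs_mul, abs_of_nonneg hr]
  exact mul_le_mul_of_nonneg_left (hf S T) hr

/-- The constants `K ≥ 0` for which each `ε`-modular set function is `K * ε`-linear. -/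
def kaltonBounds : Set ℝ :=
  {K | 0 ≤ K ∧ ∀ (n : ℕ) (ε : ℝ), 0 ≤ ε → ∀ f : Finset (Fin n) → ℝ,
    IsApproxModular ε f → IsApproxLinear (K * ε) f}

theorem mem_kaltonBounds : 12.5 ∈ kaltonBounds :=
  ⟨by norm_num, fun _ _ _ _ hf => hf.isApproxLinear⟩

theorem bddBelow_kaltonBounds : BddBelow kaltonBounds := ⟨0, fun _ hK => hK.1⟩

theorem sInf_mem_kaltonBounds : sInf kaltonBounds ∈ kaltonBounds := by
  refine ⟨Real.sInf_nonneg fun _ hK => hK.1, fun n ε hε f hf => ?_⟩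
  rw [isApproxLinear_iff_infDist_le]
  rcases hε.eq_or_lt with rfl | hpos
  · simpa using isApproxLinear_iff_infDist_le.mp (mem_kaltonBounds.2 n 0 le_rfl f hf)
  · rw [← div_le_iff₀ hpos]
    refine le_csInf ⟨_, mem_kaltonBounds⟩ fun K hK => ?_
    rw [div_le_iff₀ hpos]
    exact isApproxLinear_iff_infDist_le.mp (hK.2 n ε hε f hf)

theorem isStrongKaltonConstant_sInf : IsStrongKaltonConstant (sInf kaltonBounds) := by
  refine ⟨sInf_mem_kaltonBounds.1, sInf_mem_kaltonBounds.2, fun κ hκ ε hε => ?_⟩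
  rcases lt_or_ge κ 0 with hneg | hnonneg
  · refine ⟨0, 0, fun S T => by simpa using hε.le, ?_⟩
    rintro ⟨g, -, hg⟩
    linarith [abs_nonneg ((0 : Finset (Fin 0) → ℝ) ∅ - g ∅), hg ∅, mul_neg_of_neg_of_pos hneg hε]
  · by_contra! hcon
    refine (csInf_le bddBelow_kaltonBounds ⟨hnonneg, fun n δ hδ f hf => ?_⟩).not_gt hκ
    rcases hδ.eq_or_lt with rfl | hpos
    · simpa using mem_kaltonBounds.2 n 0 le_rfl f hf
    · -- Rescaling `f` turns the parameter `δ` into the given `ε`.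
      have h1 : IsApproxModular ε fun S => ε / δ * f S := by
        have := hf.const_mul (r := ε / δ) (by positivity)
        rwa [div_mul_cancel₀ _ hpos.ne'] at this
      have h2 := (hcon n _ h1).const_mul (r := δ / ε) (by positivity)
      convert h2 using 1
      · field_simp
      · ext S; field_simp

theorem IsStrongKaltonConstant.eq_sInf {K : ℝ} (hK : IsStrongKaltonConstant K) :
    K = sInf kaltonBounds := by
  refine le_antisymm (le_of_not_gt fun hlt => ?_) (csInf_le bddBelow_kaltonBounds ⟨hK.1, hK.2.1⟩)
  obtain ⟨n, f, hf, hnot⟩ := hK.2.2 _ hlt 1 one_pos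
  exact hnot (sInf_mem_kaltonBounds.2 n 1 zero_le_one f hf)

theorem theorem1 :
    (∀ (n : ℕ) (ε : ℝ), 0 < ε → ∀ f : Finset (Fin n) → ℝ, IsApproxModular ε f →
      ∃ Δ : ℝ, Δ < 12.65 * ε ∧ IsApproxLinear Δ f) ∧
    (∃! K : ℝ, IsStrongKaltonConstant K) ∧
    (∀ K : ℝ, IsStrongKaltonConstant K → K < 12.65) := by
  refine ⟨fun n ε hε f hf => ⟨12.5 * ε, by linarith, hf.isApproxLinear⟩,
    ⟨_, isStrongKaltonConstant_sInf, fun K hK => hK.eq_sInf⟩, fun K hK => ?_⟩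
  rw [hK.eq_sInf]
  exact (csInf_le bddBelow_kaltonBounds mem_kaltonBounds).trans_lt (by norm_num)
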